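/- Let $1\le k\le n$ be integers and let $\Lambda=(\lambda_{ij})$ be a $k\times n$ matrix of nonzero complex numbers. Let $\Gamma_{kn}$ be the full bipartite graph with vertices $1,\dots,k$ in the first row and $1,\dots,n$ in the second, and let $B_\Lambda(\Gamma_{kn})$ be the unital $\mathbb C$-algebra with generators $p_1,\dots,p_k,q_1,\dots,q_n$ and relations $p_i^2=p_i$, $q_j^2=q_j$, $p_ip_{i'}=0$ for $i\ne i'$, $q_jq_{j'}=0$ for $j\neq j'$, $p_iq_jp_i=\lambda_{ij}p_i$, $q_jp_iq_j=\lambda_{ij}q_j$. Let $\mathrm{Rep}$ be the affine variety of its representations in $\mathbb C^n$ in which all generators act by projectors of rank $1$, and let $\mathcal M_B=\mathrm{Spec}\,\mathbb C[\mathrm{Rep}]^{GL_n(\mathbb C)}$ be its GIT quotient by $GL_n(\mathbb C)$. Identify $\mathfrak{gl}_n^*$ with $\mathfrak{gl}_n$ by the form $\mathrm{Tr}\,AB$. Let $Y$ be the product of $k$ copies of the (coadjoint) orbit of rank $1$ projectors in $\mathbb C^n$, let $\mathcal O_{-P}$ be the orbit of the matrices $-P$ with $P$ a projector of rank $k$,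 and let $X\subset Y\times\mathcal O_{-P}$ be the zero level of the moment map $(p_1,\dots,p_k,-P)\mapsto\sum_i p_i-P\in\mathfrak{gl}_n^*$ of the diagonal action of $GL_n(\mathbb C)$. Let $q_j^{0}$ be the projector onto the $j$-th coordinate line of $\mathbb C^n$ along the other ones, let $F_{\lambda_{ij}}\subset Y$ be the fibre over $(\lambda_{ij})$ of the map $Y\to\mathbb C^{kn}$, $p\mapsto(\mathrm{Tr}\,p_iq_j^{0})$, and let $\mathrm{pr}_1:Y\times\mathcal O_{-P}\to Y$ be the projection. The torus $T\subset GL_n(\mathbb C)$ of diagonal matrices acts on the affine variety $Z=\mathrm{pr}_1^{-1}(F_{\lambda_{ij}})\cap X$ by simultaneous conjugation of all the $p_i$ and of $-P$. Then $\mathcal M_B$ is identified with $Z$ modulo $T$. Precisely: every $z=(p_1,\dots,p_k,-P)\in Z$ defines a representation $s(z)\in\mathrm{Rep}$ by $p_i\mapsto p_i$, $q_j\mapsto q_j^{0}$, and 1. $s$ induces an isomorphism $\mathrm{Spec}\,\mathbb C[Z]^T\cong\mathcal M_B$ of schemes over $\mathbb C$, which takes the image of $z$ to the image of $s(z)$,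 for all $z\in Z$; 2. $s$ induces a bijection from the set of $T$-orbits in $Z$ to the set of $GL_n(\mathbb C)$-orbits in $\mathrm{Rep}$; 3. the map from $Z$ to the set of $\mathbb C$-points of $\mathcal M_B$ induced by $s$ is surjective, and its fibres are exactly the $T$-orbits. -/

import Mathlib

open CategoryTheory AlgebraicGeometry

noncomputable section

/-! ## The algebra of a weighted graph -/

/-- The defining relations of `B_Λ(Γ)` in the free unital algebra on the vertices of `Γ`.  Here
`w i j` is the weight of the edge joining `i` and `j`; only its values on edges matter, and it is
meant to be symmetric. -/
inductive GraphAlgebraRel {V : Type} (Γ : SimpleGraph V) (w : V → V → ℂ) :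
    FreeAlgebra ℂ V → FreeAlgebra ℂ V → Prop
  | idem (i : V) :
      GraphAlgebraRel Γ w (FreeAlgebra.ι ℂ i * FreeAlgebra.ι ℂ i) (FreeAlgebra.ι ℂ i)
  | adj (i j : V) (h : Γ.Adj i j) :
      GraphAlgebraRel Γ w (FreeAlgebra.ι ℂ i * FreeAlgebra.ι ℂ j * FreeAlgebra.ι ℂ i)
        (w i j • FreeAlgebra.ι ℂ i)
  | nonadj (i j : V) (hne : i ≠ j) (h : ¬ Γ.Adj i j) :
      GraphAlgebraRel Γ w (FreeAlgebra.ι ℂ i * FreeAlgebra.ι ℂ j) 0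

/-- The unital `ℂ`-algebra `B_Λ(Γ)`. -/
abbrev GraphAlgebra {V : Type} (Γ : SimpleGraph V) (w : V → V → ℂ) : Type :=
  RingQuot (GraphAlgebraRel Γ w)

/-- The generator `x_i` of `B_Λ(Γ)` attached to the vertex `i`. -/
def GraphAlgebra.gen {V : Type} (Γ : SimpleGraph V) (w : V → V → ℂ) (i : V) : GraphAlgebra Γ w :=
  RingQuot.mkAlgHom ℂ (GraphAlgebraRel Γ w) (FreeAlgebra.ι ℂ i)

/-- The edge weights of the full bipartite graph `Γ_{kn}` given by a `k × n` matrix. -/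
def bipartiteWeight {k n : ℕ} (Λ : Matrix (Fin k) (Fin n) ℂ) :
    Fin k ⊕ Fin n → Fin k ⊕ Fin n → ℂ
  | Sum.inl i, Sum.inr j => Λ i j
  | Sum.inr j, Sum.inl i => Λ i j
  | _, _ => 0

/-- The algebra `B_Λ(Γ_{kn})`. -/
abbrev BAlgebra {k n : ℕ} (Λ : Matrix (Fin k) (Fin n) ℂ) : Type :=
  GraphAlgebra (completeBipartiteGraph (Fin k) (Fin n)) (bipartiteWeight Λ)

/-- The generator of `B_Λ(Γ_{kn})` attached to the vertex `i` of the first row. -/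
def BAlgebra.p {k n : ℕ} (Λ : Matrix (Fin k) (Fin n) ℂ) (i : Fin k) : BAlgebra Λ :=
  GraphAlgebra.gen _ _ (Sum.inl i)

/-- The generator of `B_Λ(Γ_{kn})` attached to the vertex `j` of the second row. -/
def BAlgebra.q {k n : ℕ} (Λ : Matrix (Fin k) (Fin n) ℂ) (j : Fin n) : BAlgebra Λ :=
  GraphAlgebra.gen _ _ (Sum.inr j)

/-! ## Conjugation -/

/-- Conjugation `A ↦ g A g⁻¹` by an invertible matrix. -/
def conjMatrix {n : ℕ} (g : GL (Fin n) ℂ) :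
    Matrix (Fin n) (Fin n) ℂ →ₐ[ℂ] Matrix (Fin n) (Fin n) ℂ where
  toFun A := g.val * A * (g⁻¹).val
  map_one' := by simp only [mul_one]; exact g.mul_inv
  map_mul' A B := by
    have h : (g⁻¹).val * g.val = 1 := g.inv_mul
    calc g.val * (A * B) * (g⁻¹).val = g.val * A * 1 * B * (g⁻¹).val := by
          simp only [mul_one, mul_assoc]
      _ = _ := by rw [← h]; simp only [mul_assoc]
  map_zero' := by simp
  map_add' A B := by simp only [mul_add, add_mul]
  commutes' r := by
    have h : g.val * (g⁻¹).val = 1 := g.mul_inv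
    rw [← Algebra.commutes, mul_assoc, h, mul_one]

theorem conjMatrix_one {n : ℕ} (A : Matrix (Fin n) (Fin n) ℂ) : conjMatrix 1 A = A := by
  simp [conjMatrix]

theorem conjMatrix_mul {n : ℕ} (g h : GL (Fin n) ℂ) (A : Matrix (Fin n) (Fin n) ℂ) :
    conjMatrix (g * h) A = conjMatrix g (conjMatrix h A) := by
  change (g * h).val * A * ((g * h)⁻¹).val = g.val * (h.val * A * (h⁻¹).val) * (g⁻¹).val
  rw [mul_inv_rev, Units.val_mul, Units.val_mul]
  simp only [mul_assoc]

theorem rank_conjMatrix {n : ℕ} (g : GL (Fin n) ℂ) (A : Matrix (Fin n) (Fin n) ℂ) :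
    (conjMatrix g A).rank = A.rank := by
  change (g.val * A * (g⁻¹).val).rank = A.rank
  rw [Matrix.rank_mul_eq_left_of_isUnit_det _ _ ((Matrix.isUnit_iff_isUnit_det _).1 (g⁻¹).isUnit),
    Matrix.rank_mul_eq_right_of_isUnit_det _ _ ((Matrix.isUnit_iff_isUnit_det _).1 g.isUnit)]

theorem trace_conjMatrix {n : ℕ} (g : GL (Fin n) ℂ) (A : Matrix (Fin n) (Fin n) ℂ) :
    (conjMatrix g A).trace = A.trace := by
  change (g.val * A * (g⁻¹).val).trace = A.trace
  have h : (g⁻¹).val * g.val = 1 := g.inv_mul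
  rw [Matrix.trace_mul_comm, ← mul_assoc, h, one_mul]

/-- The diagonal torus `T ⊂ GL_n(ℂ)`, the image of `(ℂˣ)ⁿ`. -/
def diagonalTorus (n : ℕ) : Subgroup (GL (Fin n) ℂ) :=
  ((Units.map (Matrix.diagonalRingHom (Fin n) ℂ).toMonoidHom).comp
    (MulEquiv.piUnits (M := fun _ : Fin n => ℂ)).symm.toMonoidHom).range

/-! ## Affine varieties and their GIT quotients

An affine variety over `ℂ` is given by its set `X` of points together with the coordinate
functions of a closed embedding in an affine space. -/

/-- The algebra of regular functions: the functions on `X` that are polynomials in the given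
coordinate functions. -/
def regularFunctions {X ι : Type} (coord : ι → X → ℂ) : Subalgebra ℂ (X → ℂ) :=
  Algebra.adjoin ℂ (Set.range coord)

/-- The algebra `ℂ[X]^G` of regular functions invariant under the action of `G`. -/
def invariantFunctions (G : Type) {X ι : Type} [Group G] [MulAction G X] (coord : ι → X → ℂ) :
    Subalgebra ℂ (X → ℂ) where
  carrier := {f | f ∈ regularFunctions coord ∧ ∀ (g : G) (x : X), f (g • x) = f x}
  mul_mem' ha hb := ⟨mul_mem ha.1 hb.1, fun g x => by simp [ha.2 g x, hb.2 g x]⟩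
  add_mem' ha hb := ⟨add_mem ha.1 hb.1, fun g x => by simp [ha.2 g x, hb.2 g x]⟩
  algebraMap_mem' r := ⟨Subalgebra.algebraMap_mem _ r, fun _ _ => rfl⟩

/-- The base `Spec ℂ`. -/
abbrev SpecC : Scheme := Spec (CommRingCat.of ℂ)

/-- The GIT quotient `X // G = Spec ℂ[X]^G`, as a scheme over `ℂ`. -/
def gitQuotient (G : Type) {X ι : Type} [Group G] [MulAction G X] (coord : ι → X → ℂ) :
    Over SpecC :=
  Over.mk (Spec.map (CommRingCat.ofHom (algebraMap ℂ (invariantFunctions G coord))))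

/-- Evaluation of invariant functions at a point. -/
def evalInvariant (G : Type) {X ι : Type} [Group G] [MulAction G X] (coord : ι → X → ℂ) (x : X) :
    invariantFunctions G coord →ₐ[ℂ] ℂ :=
  (Pi.evalAlgHom ℂ (fun _ : X => ℂ) x).comp (invariantFunctions G coord).val

/-- The `ℂ`-point of `X // G` that is the image of the point `x` of `X`. -/
def gitPoint (G : Type) {X ι : Type} [Group G] [MulAction G X] (coord : ι → X → ℂ) (x : X) :
    Over.mk (𝟙 SpecC) ⟶ gitQuotient G coord :=
  Over.homMk (Spec.map (CommRingCat.ofHom (evalInvariant G coord x).toRingHom)) (by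
    change Spec.map _ ≫ Spec.map _ = 𝟙 _
    rw [← Spec.map_comp, ← CommRingCat.ofHom_comp,
      (evalInvariant G coord x).toRingHom_eq_coe, AlgHom.comp_algebraMap]
    exact Spec.map_id _)

/-! ## The moduli space of representations -/

/-- Representations of `B_Λ(Γ_{kn})` of dimension `n`, in the space `ℂⁿ` with its given basis,
for which all the generators are represented by projectors of rank `1`. -/
def RankOneRep {k n : ℕ} (Λ : Matrix (Fin k) (Fin n) ℂ) : Type :=
  {ρ : BAlgebra Λ →ₐ[ℂ] Matrix (Fin n) (Fin n) ℂ //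
    (∀ i, (ρ (BAlgebra.p Λ i)).rank = 1) ∧ ∀ j, (ρ (BAlgebra.q Λ j)).rank = 1}

/-- `GL_n(ℂ)` acts on representations by change of basis. -/
instance {k n : ℕ} (Λ : Matrix (Fin k) (Fin n) ℂ) : MulAction (GL (Fin n) ℂ) (RankOneRep Λ) where
  smul g ρ := ⟨(conjMatrix g).comp ρ.1,
    fun i => (rank_conjMatrix g _).trans (ρ.2.1 i), fun j => (rank_conjMatrix g _).trans (ρ.2.2 j)⟩
  one_smul ρ := Subtype.ext (AlgHom.ext fun b => conjMatrix_one (ρ.1 b))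
  mul_smul g h ρ := Subtype.ext (AlgHom.ext fun b => conjMatrix_mul g h (ρ.1 b))

/-- The coordinates on the affine variety of representations: the matrix entries of the
generators. -/
def RankOneRep.coord {k n : ℕ} (Λ : Matrix (Fin k) (Fin n) ℂ) :
    (Fin k ⊕ Fin n) × Fin n × Fin n → RankOneRep Λ → ℂ
  | (Sum.inl i, a, b), ρ => ρ.1 (BAlgebra.p Λ i) a b
  | (Sum.inr j, a, b), ρ => ρ.1 (BAlgebra.q Λ j) a b

/-- The moduli space `M_B`: the GIT quotient of the affine variety of representations by the action
of `GL_n(ℂ)`. -/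
def moduliB {k n : ℕ} (Λ : Matrix (Fin k) (Fin n) ℂ) : Over SpecC :=
  gitQuotient (GL (Fin n) ℂ) (RankOneRep.coord Λ)

/-! ## The symplectic side

The dual of the Lie algebra `gl_n` is identified with `gl_n` by the form `Tr AB`, so that coadjoint
orbits become conjugacy classes. -/

/-- The orbit of projectors of rank `r` in `ℂⁿ`. -/
def Projector (n r : ℕ) : Type :=
  {P : Matrix (Fin n) (Fin n) ℂ // P * P = P ∧ P.rank = r}

/-- The orbit of negated projectors `-P`, where `P` is a projector of rank `r`. -/
def NegProjector (n r : ℕ) : Type :=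
  {A : Matrix (Fin n) (Fin n) ℂ // ∃ P : Projector n r, A = -P.1}

instance (n r : ℕ) : MulAction (GL (Fin n) ℂ) (Projector n r) where
  smul g P := ⟨conjMatrix g P.1, by rw [← map_mul, P.2.1], (rank_conjMatrix g _).trans P.2.2⟩
  one_smul P := Subtype.ext (conjMatrix_one P.1)
  mul_smul g h P := Subtype.ext (conjMatrix_mul g h P.1)

instance (n r : ℕ) : MulAction (GL (Fin n) ℂ) (NegProjector n r) where
  smul g A := ⟨conjMatrix g A.1, by
    obtain ⟨P, hP⟩ := A.2
    exact ⟨g • P, by rw [hP, map_neg]; rfl⟩⟩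
  one_smul A := Subtype.ext (conjMatrix_one A.1)
  mul_smul g h A := Subtype.ext (conjMatrix_mul g h A.1)

/-- `Y`, the product of `k` copies of the orbit of projectors of rank `1`. -/
abbrev orbitProduct (k n : ℕ) : Type := Fin k → Projector n 1

/-- The functional `B ↦ Tr AB` on `gl_n`. -/
def traceDual {n : ℕ} (A : Matrix (Fin n) (Fin n) ℂ) :
    Module.Dual ℂ (Matrix (Fin n) (Fin n) ℂ) :=
  (Matrix.traceLinearMap (Fin n) ℂ ℂ).comp (LinearMap.mulLeft ℂ A)

/-- The moment map `Y × O_{-P} → gl_n^*` of the diagonal action of `GL_n(ℂ)`: the sum of the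
inclusions of the orbits in `gl_n^*`. -/
def momentMap (k n : ℕ) (z : orbitProduct k n × NegProjector n k) :
    Module.Dual ℂ (Matrix (Fin n) (Fin n) ℂ) :=
  (∑ i, traceDual (z.1 i).1) + traceDual z.2.1

/-- `X`, the zero level of the moment map. -/
def zeroLevel (k n : ℕ) : Set (orbitProduct k n × NegProjector n k) :=
  momentMap k n ⁻¹' {0}

/-- The fixed complete system of orthogonal projectors `q_j` compatible with the standard basis. -/
def standardProjector {n : ℕ} (j : Fin n) : Matrix (Fin n) (Fin n) ℂ :=
  Matrix.single j j 1

/-- The integrable system on `Y` given by the functions `Tr p_i q_j`. -/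
def integrableSystem (k n : ℕ) (p : orbitProduct k n) : Matrix (Fin k) (Fin n) ℂ :=
  Matrix.of fun i j => ((p i).1 * standardProjector j).trace

/-- The fibre `F_{λ_{ij}}` of the integrable system. -/
def torusFibre {k n : ℕ} (Λ : Matrix (Fin k) (Fin n) ℂ) : Set (orbitProduct k n) :=
  integrableSystem k n ⁻¹' {Λ}

/-- The intersection `pr₁⁻¹(F_{λ_{ij}}) ∩ X`. -/
def fibreInter {k n : ℕ} (Λ : Matrix (Fin k) (Fin n) ℂ) :
    Set (orbitProduct k n × NegProjector n k) :=
  Prod.fst ⁻¹' torusFibre Λ ∩ zeroLevel k n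

theorem traceDual_conjMatrix {n : ℕ} (g : GL (Fin n) ℂ) (A B : Matrix (Fin n) (Fin n) ℂ) :
    traceDual (conjMatrix g A) B = traceDual A (conjMatrix g⁻¹ B) := by
  change (conjMatrix g A * B).trace = (A * conjMatrix g⁻¹ B).trace
  rw [← trace_conjMatrix g (A * conjMatrix g⁻¹ B), map_mul, ← conjMatrix_mul, mul_inv_cancel,
    conjMatrix_one]

theorem momentMap_smul {k n : ℕ} (g : GL (Fin n) ℂ) (z : orbitProduct k n × NegProjector n k)
    (B : Matrix (Fin n) (Fin n) ℂ) :
    momentMap k n (g • z) B = momentMap k n z (conjMatrix g⁻¹ B) := by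
  have h1 : ∀ i, ((g • z).1 i).1 = conjMatrix g (z.1 i).1 := fun _ => rfl
  have h2 : (g • z).2.1 = conjMatrix g z.2.1 := rfl
  simp only [momentMap, h1, h2, LinearMap.add_apply, LinearMap.sum_apply, traceDual_conjMatrix]

theorem conjMatrix_standardProjector {n : ℕ} (t : diagonalTorus n) (j : Fin n) :
    conjMatrix t.1 (standardProjector j) = standardProjector j := by
  obtain ⟨d, hd⟩ := t.2
  have hv : t.1.val = Matrix.diagonal fun a => (d a : ℂ) := by rw [← hd]; rfl
  have hc : t.1.val * standardProjector j = standardProjector j * t.1.val := by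
    rw [hv]
    ext a b
    rw [Matrix.diagonal_mul, Matrix.mul_diagonal]
    simp only [standardProjector, Matrix.single_apply]
    split_ifs with h
    · obtain ⟨rfl, rfl⟩ := h
      simp
    · simp
  have h : t.1.val * (t.1⁻¹).val = 1 := t.1.mul_inv
  change t.1.val * standardProjector j * (t.1⁻¹).val = _
  rw [hc, mul_assoc, h, mul_one]

theorem smul_mem_fibreInter {k n : ℕ} (Λ : Matrix (Fin k) (Fin n) ℂ) (t : diagonalTorus n)
    (z : orbitProduct k n × NegProjector n k) (hz : z ∈ fibreInter Λ) :
    t.1 • z ∈ fibreInter Λ := by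
  refine ⟨?_, ?_⟩
  · refine Eq.trans ?_ hz.1
    ext i j
    change (conjMatrix t.1 (z.1 i).1 * standardProjector j).trace
      = ((z.1 i).1 * standardProjector j).trace
    conv_lhs => rw [← conjMatrix_standardProjector t j, ← map_mul, trace_conjMatrix]
  · refine LinearMap.ext fun B => ?_
    have h : momentMap k n z = 0 := hz.2
    rw [momentMap_smul, h]
    rfl

/-- The torus `T` acts on `pr₁⁻¹(F_{λ_{ij}}) ∩ X` by simultaneous conjugation. -/
instance {k n : ℕ} (Λ : Matrix (Fin k) (Fin n) ℂ) : MulAction (diagonalTorus n) (fibreInter Λ) where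
  smul t z := ⟨t.1 • z.1, smul_mem_fibreInter Λ t z.1 z.2⟩
  one_smul z := Subtype.ext (one_smul _ z.1)
  mul_smul s t z := Subtype.ext (mul_smul s.1 t.1 z.1)

/-- The coordinates on the affine variety `pr₁⁻¹(F_{λ_{ij}}) ∩ X`: the entries of the matrices
`p_1, …, p_k` and `-P`. -/
def fibreInterCoord {k n : ℕ} (Λ : Matrix (Fin k) (Fin n) ℂ) :
    Option (Fin k) × Fin n × Fin n → fibreInter Λ → ℂ
  | (some i, a, b), z => (z.1.1 i).1 a b
  | (none, a, b), z => z.1.2.1 a b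

/-- The quotient of the affine variety `pr₁⁻¹(F_{λ_{ij}}) ∩ X` by the torus `T`. -/
def fibreInterQuotient {k n : ℕ} (Λ : Matrix (Fin k) (Fin n) ℂ) : Over SpecC :=
  gitQuotient (diagonalTorus n) (fibreInterCoord Λ)

end

/-!
Every representation `ρ` is conjugate to one of the form `s(z)`: the `q_j` are `n` orthogonal
projectors of rank one in `ℂⁿ`, so they become the coordinate projectors in a suitable basis
(`Matrix.exists_conj_eq_single_of_orthogonal`), and the relation `p_i q_j p_i = λ_ij p_i` then says
that the diagonal entries of the `p_i` are the `λ_ij`.  Conversely, if `k` projectors of rank one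
sum to a projector of rank `k`, they are pairwise orthogonal (`Matrix.mul_eq_ite_of_sum_idempotent`),
so that a point of the fibre is a representation.  The stabilizer of the coordinate projectors is
the torus `T`; hence `s` is a bijection on orbits (`fibreRep_mem_orbit_iff`,
`exists_mem_orbit_fibreRep`).

For the algebras of invariants, the point is that `s` has an inverse on orbits which is given by
invariant regular functions, so that neither reductivity nor generators of invariant rings are
needed.  Fix `o ≤ k` and `c ≤ n`.  Since `p_o` has rank one and nonzero diagonal entries, all its
entries are nonzero, and conjugation by the diagonal matrix with entries `(p_o)_{c a}` brings
`z` to a normal form, which is the same for all points of the `T`-orbit.  Its entries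
`(p_o)_{c a} (p_i)_{a b} (p_o)_{b c} / (λ_{o c} λ_{o b})` are the values at `s(z)` of the functions
`Tr (p_o q_a p_i q_b p_o q_c) / (λ_{o c} λ_{o b})`, which are regular and invariant under `GL_n` on
the whole variety of representations (`exists_normalForm`).  They define a regular map `r` from
representations to the fibre, constant on orbits, with `s ∘ r` and `r ∘ s` the identity on orbits;
the pullbacks along `s` and `r` are mutually inverse isomorphisms of algebras of invariants
(`invariantEquiv`).

The invariant functions entering the normal form separate the orbits, and a homomorphism
`ℂ[Rep]^{GL_n} → ℂ`, composed with `r^*`, is a homomorphism on the coordinate algebra of the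
fibre, which is the evaluation at a point because the fibre is closed
(`fibreInter.exists_eq_eval`, `exists_gitPoint_eq`).
-/

open Matrix

/-! ### Matrices of rank one and idempotent matrices -/

namespace Matrix

variable {K m n : Type*} [Field K] [Fintype m] [Fintype n]

theorem exists_eq_vecMulVec_of_rank_eq_one {A : Matrix m n K} (h : A.rank = 1) :
    ∃ (u : m → K) (v : n → K), A = vecMulVec u v := by
  rw [rank_eq_finrank_span_cols, finrank_eq_one_iff'] at h
  obtain ⟨⟨u, hu⟩, -, h⟩ := h
  choose v hv using fun j => h ⟨A.col j, Submodule.subset_span ⟨j, rfl⟩⟩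
  refine ⟨u, v, ?_⟩
  ext i j
  have := congrFun (congrArg Subtype.val (hv j)) i
  simp only [SetLike.mk_smul_mk, Pi.smul_apply, smul_eq_mul, col_apply] at this
  rw [vecMulVec_apply, ← this, mul_comm]

theorem mul_mul_self_of_rank_eq_one {A : Matrix m m K} (h : A.rank = 1) (B : Matrix m m K) :
    A * B * A = (A * B).trace • A := by
  obtain ⟨u, v, rfl⟩ := exists_eq_vecMulVec_of_rank_eq_one h
  rw [vecMulVec_mul, vecMulVec_mul_vecMulVec, trace_vecMulVec, dotProduct_comm,
    vecMulVec_smul]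

theorem apply_mul_apply_of_rank_eq_one {A : Matrix m n K} (h : A.rank = 1) (a b : m) (c d : n) :
    A a c * A b d = A a d * A b c := by
  obtain ⟨u, v, rfl⟩ := exists_eq_vecMulVec_of_rank_eq_one h
  simp only [vecMulVec_apply]
  ring

theorem rank_eq_trace_of_mul_self [DecidableEq m] {A : Matrix m m K} (h : A * A = A) :
    (A.rank : K) = A.trace := by
  have h1 : IsIdempotentElem (Matrix.toLin' A) := by
    rw [IsIdempotentElem, Module.End.mul_eq_comp, ← Matrix.toLin'_mul, h]
  rw [← Matrix.trace_toLin'_eq, (LinearMap.IsIdempotentElem.isProj_range _ h1).trace]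
  rfl

theorem isUnit_of_rank_eq_card [DecidableEq m] {A : Matrix m m K} (h : A.rank = Fintype.card m) :
    IsUnit A := by
  rw [← mulVec_surjective_iff_isUnit]
  have h1 : LinearMap.range A.mulVecLin = ⊤ :=
    Submodule.eq_top_of_finrank_eq (h.trans (Module.finrank_fintype_fun_eq_card K).symm)
  exact LinearMap.range_eq_top.1 h1

/-- If `U * V` is idempotent and its rank is the inner dimension, then `U` and `V` form a
biorthogonal pair.  Both sides of `(V U)³ = (V U)²` contain the invertible factor `V U`. -/
theorem mul_eq_one_of_mul_idempotent [DecidableEq m] [DecidableEq n] {U : Matrix n m K}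
    {V : Matrix m n K} (h : U * V * (U * V) = U * V) (hr : (U * V).rank = Fintype.card m) :
    V * U = 1 := by
  have hu : IsUnit (V * U) := by
    refine isUnit_of_rank_eq_card (le_antisymm (rank_le_card_width _) ?_)
    calc Fintype.card m = (U * (V * U) * V).rank := by rw [← hr, ← h]; simp only [Matrix.mul_assoc]
      _ ≤ (V * U).rank := (rank_mul_le_left _ _).trans (rank_mul_le_right _ _)
  have h3 : (V * U) * (V * U) * (V * U) = (V * U) * (V * U) * 1 := by
    calc (V * U) * (V * U) * (V * U) = V * (U * V * (U * V)) * U := by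
          simp only [Matrix.mul_assoc]
      _ = (V * U) * (V * U) * 1 := by rw [h]; simp only [Matrix.mul_assoc, Matrix.mul_one]
  exact (hu.mul hu).mul_left_cancel h3

/-- If matrices of rank one sum to a projector whose rank is their number, then they are
pairwise orthogonal projectors. -/
theorem mul_eq_ite_of_sum_idempotent [DecidableEq m] [DecidableEq n] {A : m → Matrix n n K}
    (hA : ∀ i, (A i).rank = 1) (h : (∑ i, A i) * ∑ i, A i = ∑ i, A i)
    (hr : (∑ i, A i).rank = Fintype.card m) (i j : m) :
    A i * A j = if i = j then A i else 0 := by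
  choose u v huv using fun i => exists_eq_vecMulVec_of_rank_eq_one (hA i)
  have hs : ∑ i, A i = (of u)ᵀ * of v := by
    ext a b
    simp [Matrix.sum_apply, huv, Matrix.mul_apply, vecMulVec_apply]
  rw [hs] at h hr
  have h1 : v i ⬝ᵥ u j = if i = j then 1 else 0 := by
    have := congrFun (congrFun (mul_eq_one_of_mul_idempotent h hr) i) j
    simpa [Matrix.mul_apply, dotProduct, Matrix.one_apply] using this
  rw [huv i, huv j, vecMulVec_mul_vecMulVec, h1]
  split_ifs with hij
  · subst hij; simp
  · simp

theorem sum_mul_sum_of_orthogonal [DecidableEq m] {A : m → Matrix n n K}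
    (h : ∀ i j, A i * A j = if i = j then A i else 0) :
    (∑ i, A i) * ∑ i, A i = ∑ i, A i := by
  simp [Finset.sum_mul_sum, h]

theorem rank_sum_of_orthogonal [CharZero K] [DecidableEq m] [DecidableEq n] {A : m → Matrix n n K}
    (h : ∀ i j, A i * A j = if i = j then A i else 0) (ht : ∀ i, (A i).trace = 1) :
    (∑ i, A i).rank = Fintype.card m := by
  have := rank_eq_trace_of_mul_self (sum_mul_sum_of_orthogonal h)
  rw [trace_sum] at this
  simp only [ht, Finset.sum_const, Finset.card_univ, nsmul_eq_mul, mul_one] at this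
  exact_mod_cast this

/-- A complete system of orthogonal projectors of rank one is the coordinate one in some basis. -/
theorem exists_conj_eq_single_of_orthogonal [DecidableEq m] {Q : m → Matrix m m K}
    (hQ : ∀ j, (Q j).rank = 1) (h : ∀ i j, Q i * Q j = if i = j then Q i else 0) :
    ∃ g : GL m K, ∀ j, g.val * Q j * (g⁻¹).val = single j j 1 := by
  choose x y hxy using fun j => exists_eq_vecMulVec_of_rank_eq_one (hQ j)
  have hne : ∀ j, vecMulVec (x j) (y j) ≠ 0 := by
    intro j h0
    have := hQ j
    rw [hxy, h0, rank_zero] at this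
    exact zero_ne_one this
  have hd : ∀ i j, y i ⬝ᵥ x j = if i = j then 1 else 0 := by
    intro i j
    have h1 := h i j
    rw [hxy i, hxy j, vecMulVec_mul_vecMulVec] at h1
    split_ifs at h1 ⊢ with hij
    · subst hij
      rw [vecMulVec_smul] at h1
      exact smul_left_injective K (hne i) (by simpa using h1)
    · by_contra h0
      rw [vecMulVec_smul, smul_eq_zero, or_iff_right h0] at h1
      obtain ⟨a, ha⟩ : ∃ a, x i a ≠ 0 := by
        by_contra! hx
        exact hne i (by ext a b; simp [vecMulVec_apply, hx])
      obtain ⟨b, hb⟩ : ∃ b, y j b ≠ 0 := by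
        by_contra! hx
        exact hne j (by ext a b; simp [vecMulVec_apply, hx])
      exact mul_ne_zero ha hb (congrFun (congrFun h1 a) b)
  have h1 : of y * (of x)ᵀ = 1 := by
    ext i j
    simpa [Matrix.mul_apply, dotProduct, Matrix.one_apply] using hd i j
  refine ⟨⟨of y, (of x)ᵀ, h1, mul_eq_one_comm.1 h1⟩, fun j => ?_⟩
  change of y * Q j * (of x)ᵀ = _
  ext a b
  have ha : (of y *ᵥ x j) a = if a = j then 1 else 0 := hd a j
  have hb : (y j ᵥ* (of x)ᵀ) b = if j = b then 1 else 0 := hd j b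
  rw [hxy, mul_vecMulVec, vecMulVec_mul, vecMulVec_apply, ha, hb, single_apply]
  by_cases h1 : j = a <;> by_cases h2 : j = b <;> simp [h1, h2, eq_comm]

theorem trace_mul_single_mul_single_mul_single [DecidableEq m] (A B C : Matrix m m K) (a b o : m) :
    (A * single a a 1 * B * single b b 1 * C * single o o 1).trace = A o a * B a b * C b o := by
  simp [Matrix.trace, Matrix.mul_apply, single_apply, ite_and]

end Matrix

/-! ### Points and isomorphisms of affine GIT quotients -/

section GITQuotient

variable {G H X Z ι κ : Type} [Group G] [MulAction G X] [Group H] [MulAction H Z]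
  {cX : ι → X → ℂ} {cZ : κ → Z → ℂ}

theorem coord_mem_regularFunctions (c : ι) : cX c ∈ regularFunctions cX :=
  Algebra.subset_adjoin ⟨c, rfl⟩

/-- Pullback of functions along a map of sets. -/
noncomputable def functionPullback (s : Z → X) : (X → ℂ) →ₐ[ℂ] (Z → ℂ) :=
  AlgHom.pi fun z => Pi.evalAlgHom ℂ _ (s z)

theorem functionPullback_mem_regularFunctions {s : Z → X}
    (hs : ∀ c, (fun z => cX c (s z)) ∈ regularFunctions cZ) {f : X → ℂ}
    (hf : f ∈ regularFunctions cX) : functionPullback s f ∈ regularFunctions cZ := by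
  have : regularFunctions cX ≤ (regularFunctions cZ).comap (functionPullback s) :=
    Algebra.adjoin_le (by rintro _ ⟨c, rfl⟩; exact hs c)
  exact this hf

theorem apply_eq_of_mem_orbit {f : X → ℂ} (hf : f ∈ invariantFunctions G cX) {x x' : X}
    (h : x ∈ MulAction.orbit G x') : f x = f x' := by
  obtain ⟨g, rfl⟩ := h
  exact hf.2 g x'

/-- A regular map `s : Z → X` that sends orbits into orbits induces a homomorphism
`ℂ[X]^G → ℂ[Z]^H`. -/
noncomputable def invariantPullback (s : Z → X)
    (hs : ∀ c, (fun z => cX c (s z)) ∈ regularFunctions cZ)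
    (ho : ∀ (h : H) z, s (h • z) ∈ MulAction.orbit G (s z)) :
    invariantFunctions G cX →ₐ[ℂ] invariantFunctions H cZ :=
  ((functionPullback s).comp (invariantFunctions G cX).val).codRestrict _ fun f =>
    ⟨functionPullback_mem_regularFunctions hs f.2.1,
      fun h z => apply_eq_of_mem_orbit f.2 (ho h z)⟩

/-- Regular maps `s : Z → X` and `r : X → Z` that send orbits into orbits and are mutually inverse
on orbits induce an isomorphism of the algebras of invariants. -/
noncomputable def invariantEquiv (s : Z → X) (r : X → Z)
    (hs : ∀ c, (fun z => cX c (s z)) ∈ regularFunctions cZ)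
    (hr : ∀ c, (fun x => cZ c (r x)) ∈ regularFunctions cX)
    (hso : ∀ (h : H) z, s (h • z) ∈ MulAction.orbit G (s z))
    (hro : ∀ (g : G) x, r (g • x) ∈ MulAction.orbit H (r x))
    (hsr : ∀ x, s (r x) ∈ MulAction.orbit G x) (hrs : ∀ z, r (s z) ∈ MulAction.orbit H z) :
    invariantFunctions G cX ≃ₐ[ℂ] invariantFunctions H cZ :=
  AlgEquiv.ofAlgHom (invariantPullback s hs hso) (invariantPullback r hr hro)
    (AlgHom.ext fun f => Subtype.ext (funext fun z => apply_eq_of_mem_orbit f.2 (hrs z)))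
    (AlgHom.ext fun f => Subtype.ext (funext fun x => apply_eq_of_mem_orbit f.2 (hsr x)))

/-- An isomorphism of algebras of invariants, as an isomorphism of GIT quotients over `ℂ`. -/
noncomputable def gitQuotientIso (e : invariantFunctions G cX ≃ₐ[ℂ] invariantFunctions H cZ) :
    gitQuotient H cZ ≅ gitQuotient G cX where
  hom := Over.homMk (Spec.map (CommRingCat.ofHom e.toAlgHom.toRingHom)) (by
    change Spec.map _ ≫ Spec.map _ = Spec.map _
    rw [← Spec.map_comp, ← CommRingCat.ofHom_comp, AlgHom.toRingHom_eq_coe, AlgHom.comp_algebraMap])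
  inv := Over.homMk (Spec.map (CommRingCat.ofHom e.symm.toAlgHom.toRingHom)) (by
    change Spec.map _ ≫ Spec.map _ = Spec.map _
    rw [← Spec.map_comp, ← CommRingCat.ofHom_comp, AlgHom.toRingHom_eq_coe, AlgHom.comp_algebraMap])
  hom_inv_id := by
    ext1
    change Spec.map _ ≫ Spec.map _ = 𝟙 (Spec _)
    rw [← Spec.map_comp, ← CommRingCat.ofHom_comp, ← Spec.map_id]
    congr 1
    ext f x
    exact congrFun (congrArg Subtype.val (e.apply_symm_apply f)) x
  inv_hom_id := by
    ext1
    change Spec.map _ ≫ Spec.map _ = 𝟙 (Spec _)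
    rw [← Spec.map_comp, ← CommRingCat.ofHom_comp, ← Spec.map_id]
    congr 1
    ext f x
    exact congrFun (congrArg Subtype.val (e.symm_apply_apply f)) x

theorem gitPoint_comp_gitQuotientIso_hom
    (e : invariantFunctions G cX ≃ₐ[ℂ] invariantFunctions H cZ) (s : Z → X)
    (he : ∀ f z, (e f : Z → ℂ) z = (f : X → ℂ) (s z)) (z : Z) :
    gitPoint H cZ z ≫ (gitQuotientIso e).hom = gitPoint G cX (s z) := by
  ext1
  change Spec.map _ ≫ Spec.map _ = Spec.map _
  rw [← Spec.map_comp, ← CommRingCat.ofHom_comp]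
  congr 2
  ext f
  exact he f z

/-- Two points have the same image in the quotient if and only if the invariants agree on them. -/
theorem gitPoint_eq_gitPoint_iff {x x' : X} :
    gitPoint G cX x = gitPoint G cX x' ↔ ∀ f ∈ invariantFunctions G cX, f x = f x' := by
  constructor
  · intro h f hf
    have h1 := Spec.map_injective (congrArg CommaMorphism.left h)
    exact DFunLike.congr_fun (congrArg CommRingCat.Hom.hom h1)
      (⟨f, hf⟩ : invariantFunctions G cX)
  · intro h
    ext1
    change Spec.map _ = Spec.map _
    congr 2
    ext f
    exact h f f.2

/-- A `ℂ`-point of the quotient is a homomorphism `ℂ[X]^G → ℂ`. -/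
theorem exists_algHom_of_point (m : Over.mk (𝟙 SpecC) ⟶ gitQuotient G cX) :
    ∃ φ : invariantFunctions G cX →ₐ[ℂ] ℂ, ∀ x, evalInvariant G cX x = φ → gitPoint G cX x = m := by
  obtain ⟨ψ, hψ⟩ : ∃ ψ : CommRingCat.of (invariantFunctions G cX) ⟶ CommRingCat.of ℂ,
      Spec.map ψ = m.left := Spec.map_surjective _
  have hw : Spec.map ψ ≫
      Spec.map (CommRingCat.ofHom (algebraMap ℂ (invariantFunctions G cX))) = 𝟙 SpecC :=
    (congrArg (· ≫ (gitQuotient G cX).hom) hψ).trans (Over.w m)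
  rw [← Spec.map_comp, ← Spec.map_id] at hw
  have hw' := Spec.map_injective hw
  refine ⟨{ ψ.hom with
    commutes' := fun c => DFunLike.congr_fun (congrArg CommRingCat.Hom.hom hw') c }, fun x hx => ?_⟩
  ext1
  rw [← hψ]
  change Spec.map _ = _
  congr 1
  ext f
  exact DFunLike.congr_fun hx f

/-- If every homomorphism `ℂ[Z] → ℂ` is the evaluation at a point of `Z`, then every `ℂ`-point of
`X // G` is the image of a point `s z`: a homomorphism `φ : ℂ[X]^G → ℂ` composed with
`r^* : ℂ[Z] → ℂ[X]^G` is the evaluation at some `z`, and every invariant `f` equals `r^* (s^* f)`. -/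
theorem exists_gitPoint_eq (s : Z → X) (r : X → Z)
    (hs : ∀ c, (fun z => cX c (s z)) ∈ regularFunctions cZ)
    (hr : ∀ c, (fun x => cZ c (r x)) ∈ regularFunctions cX)
    (hr_inv : ∀ (g : G) x, r (g • x) = r x) (hsr : ∀ x, s (r x) ∈ MulAction.orbit G x)
    (hZ : ∀ φ : regularFunctions cZ →ₐ[ℂ] ℂ, ∃ z, ∀ f, φ f = (f : Z → ℂ) z)
    (m : Over.mk (𝟙 SpecC) ⟶ gitQuotient G cX) : ∃ z, gitPoint G cX (s z) = m := by
  obtain ⟨φ, hφ⟩ := exists_algHom_of_point m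
  let R : regularFunctions cZ →ₐ[ℂ] invariantFunctions G cX :=
    ((functionPullback r).comp (regularFunctions cZ).val).codRestrict _ fun f =>
      ⟨functionPullback_mem_regularFunctions hr f.2, fun g x => congrArg (f : Z → ℂ) (hr_inv g x)⟩
  obtain ⟨z, hz⟩ := hZ (φ.comp R)
  refine ⟨z, hφ _ (AlgHom.ext fun f => ?_)⟩
  have hf := hz ⟨functionPullback s f.1, functionPullback_mem_regularFunctions hs f.2.1⟩
  have hR : R ⟨functionPullback s f.1, functionPullback_mem_regularFunctions hs f.2.1⟩ = f :=
    Subtype.ext (funext fun x => apply_eq_of_mem_orbit f.2 (hsr x))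
  rw [AlgHom.comp_apply, hR] at hf
  exact hf.symm

end GITQuotient

/-! ### Representations of the algebra of the full bipartite graph -/

section BipartiteAlgebra

variable {k n : ℕ} {Λ : Matrix (Fin k) (Fin n) ℂ}

theorem GraphAlgebra.gen_mul_self {V : Type} (Γ : SimpleGraph V) (w : V → V → ℂ) (i : V) :
    gen Γ w i * gen Γ w i = gen Γ w i := by
  have := RingQuot.mkAlgHom_rel ℂ (GraphAlgebraRel.idem (Γ := Γ) (w := w) i)
  rwa [map_mul] at this

theorem GraphAlgebra.gen_mul_gen_of_not_adj {V : Type} {Γ : SimpleGraph V} (w : V → V → ℂ) {i j : V}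
    (hne : i ≠ j) (h : ¬ Γ.Adj i j) : gen Γ w i * gen Γ w j = 0 := by
  have := RingQuot.mkAlgHom_rel ℂ (GraphAlgebraRel.nonadj (Γ := Γ) (w := w) i j hne h)
  rwa [map_mul, map_zero] at this

theorem GraphAlgebra.gen_mul_gen_mul_gen {V : Type} {Γ : SimpleGraph V} (w : V → V → ℂ) {i j : V}
    (h : Γ.Adj i j) : gen Γ w i * gen Γ w j * gen Γ w i = w i j • gen Γ w i := by
  have := RingQuot.mkAlgHom_rel ℂ (GraphAlgebraRel.adj (Γ := Γ) (w := w) i j h)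
  rwa [map_mul, map_mul, map_smul] at this

theorem BAlgebra.p_mul_p (i j : Fin k) :
    BAlgebra.p Λ i * BAlgebra.p Λ j = if i = j then BAlgebra.p Λ i else 0 := by
  split_ifs with h
  · subst h
    exact GraphAlgebra.gen_mul_self _ _ _
  · exact GraphAlgebra.gen_mul_gen_of_not_adj _ (by simpa using h) (by simp)

theorem BAlgebra.q_mul_q (i j : Fin n) :
    BAlgebra.q Λ i * BAlgebra.q Λ j = if i = j then BAlgebra.q Λ i else 0 := by
  split_ifs with h
  · subst h
    exact GraphAlgebra.gen_mul_self _ _ _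
  · exact GraphAlgebra.gen_mul_gen_of_not_adj _ (by simpa using h) (by simp)

theorem BAlgebra.p_mul_q_mul_p (i : Fin k) (j : Fin n) :
    BAlgebra.p Λ i * BAlgebra.q Λ j * BAlgebra.p Λ i = Λ i j • BAlgebra.p Λ i :=
  GraphAlgebra.gen_mul_gen_mul_gen _ (by simp)

theorem BAlgebra.algHom_ext {A : Type*} [Semiring A] [Algebra ℂ A] {f g : BAlgebra Λ →ₐ[ℂ] A}
    (hp : ∀ i, f (BAlgebra.p Λ i) = g (BAlgebra.p Λ i))
    (hq : ∀ j, f (BAlgebra.q Λ j) = g (BAlgebra.q Λ j)) : f = g := by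
  refine RingQuot.ringQuot_ext' ℂ f g (FreeAlgebra.hom_ext (funext fun v => ?_))
  rcases v with i | j
  · exact hp i
  · exact hq j

/-- Elements of an algebra satisfying the defining relations of `B_Λ(Γ_{kn})` define a homomorphism. -/
theorem BAlgebra.exists_algHom {A : Type*} [Ring A] [Algebra ℂ A] (x : Fin k → A) (y : Fin n → A)
    (hx : ∀ i j, x i * x j = if i = j then x i else 0)
    (hy : ∀ i j, y i * y j = if i = j then y i else 0)
    (hxy : ∀ i j, x i * y j * x i = Λ i j • x i) (hyx : ∀ i j, y j * x i * y j = Λ i j • y j) :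
    ∃ f : BAlgebra Λ →ₐ[ℂ] A,
      (∀ i, f (BAlgebra.p Λ i) = x i) ∧ ∀ j, f (BAlgebra.q Λ j) = y j := by
  have hrel : ∀ ⦃a b⦄, GraphAlgebraRel (completeBipartiteGraph (Fin k) (Fin n))
      (bipartiteWeight Λ) a b →
      FreeAlgebra.lift ℂ (Sum.elim x y) a = FreeAlgebra.lift ℂ (Sum.elim x y) b := by
    intro a b h
    cases h with
    | idem v => rcases v with i | j <;> simp [hx, hy]
    | adj v w h =>
      rcases v with i | j <;> rcases w with i' | j' <;> simp at h <;>
        simp [hxy, hyx, bipartiteWeight]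
    | nonadj v w hne h =>
      rcases v with i | j <;> rcases w with i' | j' <;> simp at h hne <;> simp [hx, hy, hne]
  refine ⟨RingQuot.liftAlgHom ℂ ⟨FreeAlgebra.lift ℂ (Sum.elim x y), hrel⟩, fun i => ?_, fun j => ?_⟩
  · exact (RingQuot.liftAlgHom_mkAlgHom_apply ℂ _ _ _).trans (by simp)
  · exact (RingQuot.liftAlgHom_mkAlgHom_apply ℂ _ _ _).trans (by simp)

namespace RankOneRep

theorem ext_gen {ρ σ : RankOneRep Λ} (hp : ∀ i, ρ.1 (BAlgebra.p Λ i) = σ.1 (BAlgebra.p Λ i))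
    (hq : ∀ j, ρ.1 (BAlgebra.q Λ j) = σ.1 (BAlgebra.q Λ j)) : ρ = σ :=
  Subtype.ext (BAlgebra.algHom_ext hp hq)

theorem trace_p (ρ : RankOneRep Λ) (i : Fin k) : (ρ.1 (BAlgebra.p Λ i)).trace = 1 := by
  rw [← rank_eq_trace_of_mul_self (by rw [← map_mul, BAlgebra.p_mul_p, if_pos rfl]), ρ.2.1 i,
    Nat.cast_one]

theorem trace_p_mul_q (ρ : RankOneRep Λ) (i : Fin k) (j : Fin n) :
    (ρ.1 (BAlgebra.p Λ i) * ρ.1 (BAlgebra.q Λ j)).trace = Λ i j := by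
  have h := congrArg Matrix.trace (congrArg ρ.1 (BAlgebra.p_mul_q_mul_p (Λ := Λ) i j))
  rw [map_mul, map_mul, mul_mul_self_of_rank_eq_one (ρ.2.1 i), map_smul, trace_smul, trace_smul,
    trace_p] at h
  simpa using h

theorem p_mul_p (ρ : RankOneRep Λ) (i j : Fin k) :
    ρ.1 (BAlgebra.p Λ i) * ρ.1 (BAlgebra.p Λ j) = if i = j then ρ.1 (BAlgebra.p Λ i) else 0 := by
  rw [← map_mul, BAlgebra.p_mul_p, apply_ite ρ.1, map_zero]

theorem q_mul_q (ρ : RankOneRep Λ) (i j : Fin n) :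
    ρ.1 (BAlgebra.q Λ i) * ρ.1 (BAlgebra.q Λ j) = if i = j then ρ.1 (BAlgebra.q Λ i) else 0 := by
  rw [← map_mul, BAlgebra.q_mul_q, apply_ite ρ.1, map_zero]

theorem smul_apply (g : GL (Fin n) ℂ) (ρ : RankOneRep Λ) (b : BAlgebra Λ) :
    (g • ρ).1 b = conjMatrix g (ρ.1 b) := rfl

theorem entry_mem_regularFunctions_of_mul {b c : BAlgebra Λ}
    (hb : ∀ x y, (fun ρ : RankOneRep Λ => ρ.1 b x y) ∈ regularFunctions (RankOneRep.coord Λ))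
    (hc : ∀ x y, (fun ρ : RankOneRep Λ => ρ.1 c x y) ∈ regularFunctions (RankOneRep.coord Λ))
    (x y : Fin n) :
    (fun ρ : RankOneRep Λ => ρ.1 (b * c) x y) ∈ regularFunctions (RankOneRep.coord Λ) := by
  have : (fun ρ : RankOneRep Λ => ρ.1 (b * c) x y) =
      ∑ w, (fun ρ : RankOneRep Λ => ρ.1 b x w) * fun ρ => ρ.1 c w y := by
    ext ρ
    simp [Matrix.mul_apply]
  rw [this]
  exact sum_mem fun w _ => mul_mem (hb x w) (hc w y)

end RankOneRep

end BipartiteAlgebra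

/-! ### The fibre of the integrable system in the zero level of the moment map -/

section Fibre

variable {k n : ℕ} {Λ : Matrix (Fin k) (Fin n) ℂ}

theorem trace_mul_standardProjector (A : Matrix (Fin n) (Fin n) ℂ) (j : Fin n) :
    (A * standardProjector j).trace = A j j := by
  simp [standardProjector, Matrix.trace_mul_single]

theorem rank_standardProjector (j : Fin n) : (standardProjector j).rank = 1 := by
  have h : (standardProjector j * standardProjector j : Matrix (Fin n) (Fin n) ℂ) =
    standardProjector j := by simp [standardProjector]
  have := rank_eq_trace_of_mul_self h
  rw [standardProjector, trace_single_eq_same] at this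
  exact_mod_cast this

theorem standardProjector_mul (i j : Fin n) : (standardProjector i * standardProjector j :
    Matrix (Fin n) (Fin n) ℂ) = if i = j then standardProjector i else 0 := by
  split_ifs with h
  · subst h; simp [standardProjector]
  · simp [standardProjector, h]

theorem momentMap_eq_zero_iff (z : orbitProduct k n × NegProjector n k) :
    momentMap k n z = 0 ↔ z.2.1 = -∑ i, (z.1 i).1 := by
  have h : ∀ B, momentMap k n z B = (((∑ i, (z.1 i).1) + z.2.1) * B).trace := by
    intro B
    simp [momentMap, traceDual, add_mul, Finset.sum_mul, trace_sum]
  rw [eq_neg_iff_add_eq_zero, add_comm]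
  constructor
  · intro h0
    ext a b
    have := h (Matrix.single b a 1)
    rw [h0, trace_mul_single] at this
    simpa using this.symm
  · intro h0
    ext1 B
    rw [h, h0]
    simp

namespace fibreInter

theorem snd_eq (z : fibreInter Λ) : z.1.2.1 = -∑ i, (z.1.1 i).1 :=
  (momentMap_eq_zero_iff z.1).1 z.2.2

theorem ext_fst {z z' : fibreInter Λ} (h : ∀ i, (z.1.1 i).1 = (z'.1.1 i).1) : z = z' := by
  refine Subtype.ext (Prod.ext (funext fun i => Subtype.ext (h i)) (Subtype.ext ?_))
  rw [snd_eq, snd_eq]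
  simp only [h]

theorem apply_self (z : fibreInter Λ) (i : Fin k) (j : Fin n) : (z.1.1 i).1 j j = Λ i j := by
  refine (trace_mul_standardProjector _ j).symm.trans ?_
  exact congrFun (congrFun z.2.1 i) j

theorem mul_eq_ite (z : fibreInter Λ) (i j : Fin k) :
    (z.1.1 i).1 * (z.1.1 j).1 = if i = j then (z.1.1 i).1 else 0 := by
  obtain ⟨P, hP⟩ := z.1.2.2
  have h : ∑ i, (z.1.1 i).1 = P.1 := neg_injective ((snd_eq z).symm.trans hP)
  refine mul_eq_ite_of_sum_idempotent (A := fun i => (z.1.1 i).1) (fun i => (z.1.1 i).2.2) ?_ ?_ i j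
  · rw [h]; exact P.2.1
  · rw [h, Fintype.card_fin]; exact P.2.2

/-- Pairwise orthogonal projectors of trace one with prescribed diagonals form a point of the
fibre: their sum is then a projector of rank `k`. -/
theorem exists_of_orthogonal (A : Fin k → Matrix (Fin n) (Fin n) ℂ)
    (hA : ∀ i j, A i * A j = if i = j then A i else 0) (ht : ∀ i, (A i).trace = 1)
    (hd : ∀ i j, A i j j = Λ i j) : ∃ z : fibreInter Λ, ∀ i, (z.1.1 i).1 = A i := by
  have hidem : ∀ i, A i * A i = A i := fun i => by rw [hA, if_pos rfl]
  have hrank : ∀ i, (A i).rank = 1 := fun i => by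
    have := rank_eq_trace_of_mul_self (hidem i)
    rw [ht i] at this
    exact_mod_cast this
  refine ⟨⟨(fun i => ⟨A i, hidem i, hrank i⟩, ⟨-∑ i, A i, ⟨∑ i, A i, sum_mul_sum_of_orthogonal hA,
    (rank_sum_of_orthogonal hA ht).trans (Fintype.card_fin k)⟩, rfl⟩), ?_, ?_⟩, fun i => rfl⟩
  · ext i j
    exact (trace_mul_standardProjector _ _).trans (hd i j)
  · exact (momentMap_eq_zero_iff _).2 rfl

theorem smul_fst (t : diagonalTorus n) (z : fibreInter Λ) (i : Fin k) :
    ((t • z).1.1 i).1 = conjMatrix t.1 (z.1.1 i).1 := rfl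

theorem trace_eq_one (z : fibreInter Λ) (i : Fin k) : (z.1.1 i).1.trace = 1 := by
  rw [← rank_eq_trace_of_mul_self (z.1.1 i).2.1, (z.1.1 i).2.2, Nat.cast_one]

/-- The fibre is Zariski closed in the space of tuples of matrices: a homomorphism from its
coordinate algebra to `ℂ` is the evaluation at one of its points. -/
theorem exists_eq_eval (φ : regularFunctions (fibreInterCoord Λ) →ₐ[ℂ] ℂ) :
    ∃ z : fibreInter Λ, ∀ f, φ f = (f : fibreInter Λ → ℂ) z := by
  let M : Fin k → Matrix (Fin n) (Fin n) (regularFunctions (fibreInterCoord Λ)) := fun i =>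
    Matrix.of fun a b => ⟨fibreInterCoord Λ (some i, a, b), coord_mem_regularFunctions _⟩
  have hM : ∀ i a b z, (M i a b : fibreInter Λ → ℂ) z = (z.1.1 i).1 a b := fun _ _ _ _ => rfl
  have hmul : ∀ i j, M i * M j = if i = j then M i else 0 := by
    intro i j
    ext a b z
    have := congrFun (congrFun (mul_eq_ite z i j) a) b
    rw [Matrix.mul_apply] at this ⊢
    split_ifs at this ⊢ <;> simpa [hM] using this
  obtain ⟨z, hz⟩ := exists_of_orthogonal (Λ := Λ) (fun i => (M i).map φ)
    (fun i j => by
      have := congrArg (fun N => N.map φ) (hmul i j)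
      rw [Matrix.map_mul] at this
      rw [this]
      split_ifs
      · rfl
      · exact Matrix.map_zero _ (map_zero φ))
    (fun i => by
      have : (M i).trace = 1 := by
        ext z
        simpa [Matrix.trace, hM] using trace_eq_one z i
      rw [← AddMonoidHom.map_trace, this, map_one])
    (fun i j => by
      have : M i j j = algebraMap ℂ _ (Λ i j) := by
        ext z
        exact apply_self z i j
      rw [Matrix.map_apply, this, AlgHom.commutes]
      rfl)
  have hsome : ∀ i a b, φ (M i a b) = (z.1.1 i).1 a b := fun i a b => by rw [hz]; rfl
  have key : φ =
      (Pi.evalAlgHom ℂ (fun _ => ℂ) z).comp (regularFunctions (fibreInterCoord Λ)).val := by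
    refine AlgHom.adjoin_ext ?_
    rintro _ ⟨⟨_ | i, a, b⟩, rfl⟩
    · have : (⟨fibreInterCoord Λ (none, a, b), coord_mem_regularFunctions _⟩ :
          regularFunctions (fibreInterCoord Λ)) = -∑ i, M i a b := by
        ext z
        exact (congrFun (congrFun (snd_eq z) a) b).trans (by simp [hM, Matrix.sum_apply])
      refine (congrArg φ this).trans ?_
      change _ = z.1.2.1 a b
      rw [snd_eq, map_neg, map_sum, Matrix.neg_apply, Matrix.sum_apply]
      simp only [hsome]
    · exact hsome i a b
  exact ⟨z, fun f => DFunLike.congr_fun key f⟩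

end fibreInter

end Fibre

/-! ### Comparison of the orbits -/

section Orbits

variable {k n : ℕ} {Λ : Matrix (Fin k) (Fin n) ℂ}

theorem exists_rep_of_fibre (z : fibreInter Λ) : ∃ ρ : RankOneRep Λ,
    (∀ i, ρ.1 (BAlgebra.p Λ i) = (z.1.1 i).1) ∧
      ∀ j, ρ.1 (BAlgebra.q Λ j) = standardProjector j := by
  obtain ⟨f, hp, hq⟩ := BAlgebra.exists_algHom (Λ := Λ) (fun i => (z.1.1 i).1) standardProjector
    (fibreInter.mul_eq_ite z) standardProjector_mul
    (fun i j => by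
      rw [mul_mul_self_of_rank_eq_one (z.1.1 i).2.2, trace_mul_standardProjector,
        fibreInter.apply_self])
    (fun i j => by
      rw [mul_mul_self_of_rank_eq_one (rank_standardProjector j), trace_mul_comm,
        trace_mul_standardProjector, fibreInter.apply_self])
  exact ⟨⟨f, fun i => by rw [hp]; exact (z.1.1 i).2.2,
    fun j => by rw [hq]; exact rank_standardProjector j⟩, hp, hq⟩

/-- The representation given by a point of the fibre and the coordinate projectors. -/
noncomputable def fibreRep (z : fibreInter Λ) : RankOneRep Λ := (exists_rep_of_fibre z).choose

theorem fibreRep_p (z : fibreInter Λ) (i : Fin k) :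
    (fibreRep z).1 (BAlgebra.p Λ i) = (z.1.1 i).1 := (exists_rep_of_fibre z).choose_spec.1 i

theorem fibreRep_q (z : fibreInter Λ) (j : Fin n) :
    (fibreRep z).1 (BAlgebra.q Λ j) = standardProjector j :=
  (exists_rep_of_fibre z).choose_spec.2 j

theorem fibreRep_smul (t : diagonalTorus n) (z : fibreInter Λ) :
    fibreRep (t • z) = t.1 • fibreRep z := by
  refine RankOneRep.ext_gen (fun i => ?_) (fun j => ?_)
  · rw [RankOneRep.smul_apply, fibreRep_p, fibreRep_p, fibreInter.smul_fst]
  · rw [RankOneRep.smul_apply, fibreRep_q, fibreRep_q, conjMatrix_standardProjector]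

/-- Diagonalizing the `q_j` simultaneously brings a representation to the form `s(z)`. -/
theorem exists_mem_orbit_fibreRep (ρ : RankOneRep Λ) :
    ∃ z : fibreInter Λ, ρ ∈ MulAction.orbit (GL (Fin n) ℂ) (fibreRep z) := by
  obtain ⟨g, hg⟩ := exists_conj_eq_single_of_orthogonal ρ.2.2 ρ.q_mul_q
  have hq : ∀ j, (g • ρ).1 (BAlgebra.q Λ j) = standardProjector j := hg
  obtain ⟨z, hz⟩ := fibreInter.exists_of_orthogonal (Λ := Λ)
    (fun i => (g • ρ).1 (BAlgebra.p Λ i)) (g • ρ).p_mul_p (g • ρ).trace_p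
    (fun i j => (trace_mul_standardProjector _ j).symm.trans (by
      rw [← hq]
      exact (g • ρ).trace_p_mul_q i j))
  refine ⟨z, g⁻¹, ?_⟩
  change g⁻¹ • fibreRep z = ρ
  rw [inv_smul_eq_iff]
  exact RankOneRep.ext_gen (fun i => by rw [fibreRep_p, hz]) (fun j => by rw [fibreRep_q, hq])

theorem diagonal_mem_diagonalTorus (d : Fin n → ℂˣ) :
    ∃ t : diagonalTorus n, t.1.val = diagonal (fun a => (d a : ℂ)) ∧
      (t.1⁻¹).val = diagonal (fun a => (d a : ℂ)⁻¹) := by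
  refine ⟨⟨_, d, rfl⟩, rfl, ?_⟩
  rw [← map_inv]
  change diagonal (fun a => ((d⁻¹) a : ℂ)) = _
  simp

/-- The torus is the stabilizer of the coordinate projectors. -/
theorem mem_diagonalTorus_of_conjMatrix_eq {g : GL (Fin n) ℂ}
    (h : ∀ j, conjMatrix g (standardProjector j) = standardProjector j) : g ∈ diagonalTorus n := by
  have hcomm : ∀ j, g.val * standardProjector j = standardProjector j * g.val := by
    intro j
    have h1 : g.val * standardProjector j * (g⁻¹).val = standardProjector j := h j
    have h2 : (g⁻¹).val * g.val = 1 := g.inv_mul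
    rw [← congrArg (· * g.val) h1]
    simp only [Matrix.mul_assoc, h2, Matrix.mul_one]
  have hoff : ∀ a j, a ≠ j → g.val a j = 0 := by
    intro a j haj
    have := congrFun (congrFun (hcomm j) a) j
    simpa [standardProjector, Matrix.mul_apply, single_apply, haj.symm] using this
  have hmul : ∀ j, g.val j j * (g⁻¹).val j j = 1 := by
    intro j
    have h2 : g.val * (g⁻¹).val = 1 := g.mul_inv
    have := congrFun (congrFun h2 j) j
    rw [Matrix.mul_apply, Finset.sum_eq_single j (fun a _ ha => by rw [hoff j a ha.symm, zero_mul])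
      (by simp), one_apply_eq] at this
    exact this
  obtain ⟨t, ht, -⟩ := diagonal_mem_diagonalTorus (n := n)
    fun j => ⟨g.val j j, (g⁻¹).val j j, hmul j, by rw [mul_comm, hmul j]⟩
  have : g = t.1 := by
    refine Units.ext ?_
    rw [ht]
    ext a b
    rcases eq_or_ne a b with rfl | hab
    · simp
    · rw [diagonal_apply_ne _ hab, hoff a b hab]
  rw [this]
  exact t.2

theorem fibreRep_mem_orbit_iff (z z' : fibreInter Λ) :
    fibreRep z ∈ MulAction.orbit (GL (Fin n) ℂ) (fibreRep z') ↔
      z ∈ MulAction.orbit (diagonalTorus n) z' := by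
  constructor
  · rintro ⟨g, hg⟩
    have hg : ∀ b, conjMatrix g ((fibreRep z').1 b) = (fibreRep z).1 b := fun b => by
      rw [← RankOneRep.smul_apply]
      exact DFunLike.congr_fun (congrArg Subtype.val hg) b
    have hT : g ∈ diagonalTorus n := mem_diagonalTorus_of_conjMatrix_eq fun j => by
      have := hg (BAlgebra.q Λ j)
      rwa [fibreRep_q, fibreRep_q] at this
    refine ⟨⟨g, hT⟩, fibreInter.ext_fst fun i => ?_⟩
    have := hg (BAlgebra.p Λ i)
    rwa [fibreRep_p, fibreRep_p] at this
  · rintro ⟨t, rfl⟩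
    exact ⟨t.1, (fibreRep_smul t z').symm⟩

end Orbits

/-! ### The normal form of a representation -/

section NormalForm

variable {k n : ℕ} {Λ : Matrix (Fin k) (Fin n) ℂ}

/-- The element `p_o q_a p_i q_b p_o q_c` of `B_Λ(Γ_{kn})`. -/
noncomputable def normalFormWord (Λ : Matrix (Fin k) (Fin n) ℂ) (o : Fin k) (c : Fin n) (i : Fin k)
    (a b : Fin n) : BAlgebra Λ :=
  BAlgebra.p Λ o * BAlgebra.q Λ a * BAlgebra.p Λ i * BAlgebra.q Λ b * BAlgebra.p Λ o *
    BAlgebra.q Λ c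

/-- The `(a, b)` entry of the image of `p_i` in the normal form of a representation. -/
noncomputable def normalFormEntry (o : Fin k) (c : Fin n) (i : Fin k) (a b : Fin n)
    (ρ : RankOneRep Λ) : ℂ :=
  (Λ o c * Λ o b)⁻¹ * (ρ.1 (normalFormWord Λ o c i a b)).trace

theorem normalFormEntry_smul (o : Fin k) (c : Fin n) (i : Fin k) (a b : Fin n) (g : GL (Fin n) ℂ)
    (ρ : RankOneRep Λ) : normalFormEntry o c i a b (g • ρ) = normalFormEntry o c i a b ρ := by
  rw [normalFormEntry, normalFormEntry, RankOneRep.smul_apply, trace_conjMatrix]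

theorem normalFormEntry_mem_regularFunctions (o : Fin k) (c : Fin n) (i : Fin k) (a b : Fin n) :
    normalFormEntry (Λ := Λ) o c i a b ∈ regularFunctions (RankOneRep.coord Λ) := by
  have hp : ∀ i x y, (fun ρ : RankOneRep Λ => ρ.1 (BAlgebra.p Λ i) x y) ∈
    regularFunctions (RankOneRep.coord Λ) := fun i x y =>
      coord_mem_regularFunctions (cX := RankOneRep.coord Λ) (Sum.inl i, x, y)
  have hq : ∀ j x y, (fun ρ : RankOneRep Λ => ρ.1 (BAlgebra.q Λ j) x y) ∈
    regularFunctions (RankOneRep.coord Λ) := fun j x y =>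
      coord_mem_regularFunctions (cX := RankOneRep.coord Λ) (Sum.inr j, x, y)
  have hmul := fun b c => RankOneRep.entry_mem_regularFunctions_of_mul (Λ := Λ) (b := b) (c := c)
  have hw := hmul _ _ (hmul _ _ (hmul _ _ (hmul _ _ (hmul _ _ (hp o) (hq a)) (hp i)) (hq b)) (hp o))
    (hq c)
  have : normalFormEntry (Λ := Λ) o c i a b = (Λ o c * Λ o b)⁻¹ •
      ∑ x, fun ρ : RankOneRep Λ => ρ.1 (normalFormWord Λ o c i a b) x x := by
    ext ρ
    simp [normalFormEntry, Matrix.trace]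
  rw [this]
  exact Subalgebra.smul_mem _ (sum_mem fun x _ => hw x x) _

/-- The normal form of `s(z)` is a point of the torus orbit of `z`: the diagonal matrix with
entries `(p_o)_{c a}` brings `z` to the form in which `(p_o)_{c a}` is replaced by the constant
`λ_{o c}`. -/
theorem exists_smul_eq_normalFormEntry (hΛ : ∀ i j, Λ i j ≠ 0) (o : Fin k) (c : Fin n)
    (z : fibreInter Λ) : ∃ t : diagonalTorus n, ∀ i a b,
      ((t • z).1.1 i).1 a b = normalFormEntry o c i a b (fibreRep z) := by
  -- As `p_o` has rank one, `(p_o)_{c a} (p_o)_{a c} = λ_{o c} λ_{o a}`, so `(p_o)_{c a}` is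
  -- nonzero and its inverse is a polynomial in the entries.
  have hprod : ∀ a, (z.1.1 o).1 c a * (z.1.1 o).1 a c = Λ o c * Λ o a := fun a => by
    rw [apply_mul_apply_of_rank_eq_one (z.1.1 o).2.2, fibreInter.apply_self, fibreInter.apply_self]
  have hne : ∀ a, (z.1.1 o).1 c a ≠ 0 := fun a h0 => by
    have := hprod a
    rw [h0, zero_mul] at this
    exact mul_ne_zero (hΛ o c) (hΛ o a) this.symm
  have hinv : ∀ a, ((z.1.1 o).1 c a)⁻¹ = (Λ o c * Λ o a)⁻¹ * (z.1.1 o).1 a c := fun a => by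
    rw [← hprod, mul_inv, mul_assoc, inv_mul_cancel₀, mul_one]
    intro h0
    have := hprod a
    rw [h0, mul_zero] at this
    exact mul_ne_zero (hΛ o c) (hΛ o a) this.symm
  obtain ⟨t, ht, ht'⟩ := diagonal_mem_diagonalTorus fun a => Units.mk0 _ (hne a)
  refine ⟨t, fun i a b => ?_⟩
  have h1 : conjMatrix t.1 (z.1.1 i).1 = t.1.val * (z.1.1 i).1 * (t.1⁻¹).val := rfl
  rw [fibreInter.smul_fst, h1, ht, ht', mul_diagonal, diagonal_mul, normalFormEntry, normalFormWord]
  simp only [map_mul, fibreRep_p, fibreRep_q, Units.val_mk0]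
  have h2 := trace_mul_single_mul_single_mul_single (z.1.1 o).1 (z.1.1 i).1 (z.1.1 o).1 a b c
  simp only [standardProjector]
  rw [h2, hinv]
  ring

/-- Every representation `ρ` has a normal form in the fibre, whose entries are invariant regular
functions of `ρ`. -/
theorem exists_normalForm (hΛ : ∀ i j, Λ i j ≠ 0) (o : Fin k) (c : Fin n) (ρ : RankOneRep Λ) :
    ∃ z : fibreInter Λ, (∀ i a b, (z.1.1 i).1 a b = normalFormEntry o c i a b ρ) ∧
      fibreRep z ∈ MulAction.orbit (GL (Fin n) ℂ) ρ := by
  obtain ⟨z, g, rfl⟩ := exists_mem_orbit_fibreRep ρ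
  obtain ⟨t, ht⟩ := exists_smul_eq_normalFormEntry hΛ o c z
  refine ⟨t • z, fun i a b => (ht i a b).trans (normalFormEntry_smul o c i a b g _).symm, ?_⟩
  rw [MulAction.orbit_smul, fibreRep_smul]
  exact MulAction.mem_orbit _ _

end NormalForm

/-! ### The moduli space -/

theorem fibreRep_coord_mem_regularFunctions {k n : ℕ} {Λ : Matrix (Fin k) (Fin n) ℂ}
    (x : (Fin k ⊕ Fin n) × Fin n × Fin n) :
    (fun z => RankOneRep.coord Λ x (fibreRep z)) ∈ regularFunctions (fibreInterCoord Λ) := by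
  obtain ⟨i | j, a, b⟩ := x
  · have : (fun z => RankOneRep.coord Λ (Sum.inl i, a, b) (fibreRep z)) =
        fibreInterCoord Λ (some i, a, b) := by
      ext z
      simp [RankOneRep.coord, fibreInterCoord, fibreRep_p]
    rw [this]
    exact coord_mem_regularFunctions _
  · have : (fun z => RankOneRep.coord Λ (Sum.inr j, a, b) (fibreRep z)) =
        algebraMap ℂ _ (standardProjector j a b) := by
      ext z
      simp [RankOneRep.coord, fibreRep_q]
    rw [this]
    exact Subalgebra.algebraMap_mem _ _

theorem mainTheorem5 (k n : ℕ) (hk : 0 < k) (hkn : k ≤ n) (Λ : Matrix (Fin k) (Fin n) ℂ)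
    (hΛ : ∀ i j, Λ i j ≠ 0) :
    ∃ (s : fibreInter Λ → RankOneRep Λ) (Φ : fibreInterQuotient Λ ≅ moduliB Λ),
      -- `s` sends `(p, -P)` to the representation given by the `p_i` and the standard `q_j`
      (∀ z i, (s z).1 (BAlgebra.p Λ i) = (z.1.1 i).1) ∧
      (∀ z j, (s z).1 (BAlgebra.q Λ j) = standardProjector j) ∧
      -- `Φ` is an isomorphism of schemes over `ℂ`, induced by `s`
      (∀ z, gitPoint (diagonalTorus n) (fibreInterCoord Λ) z ≫ Φ.hom =
        gitPoint (GL (Fin n) ℂ) (RankOneRep.coord Λ) (s z)) ∧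
      -- `s` induces a bijection from `T`-orbits to `GL_n`-orbits
      (∀ z z', s z ∈ MulAction.orbit (GL (Fin n) ℂ) (s z') ↔
        z ∈ MulAction.orbit (diagonalTorus n) z') ∧
      (∀ ρ, ∃ z, ρ ∈ MulAction.orbit (GL (Fin n) ℂ) (s z)) ∧
      -- the points of `M_B` are exactly the `T`-orbits
      (∀ z z', gitPoint (GL (Fin n) ℂ) (RankOneRep.coord Λ) (s z) =
          gitPoint (GL (Fin n) ℂ) (RankOneRep.coord Λ) (s z') ↔
        z ∈ MulAction.orbit (diagonalTorus n) z') ∧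
      (∀ m : Over.mk (𝟙 SpecC) ⟶ moduliB Λ,
        ∃ z, gitPoint (GL (Fin n) ℂ) (RankOneRep.coord Λ) (s z) = m) := by
  let o : Fin k := ⟨0, hk⟩
  let c : Fin n := ⟨0, hk.trans_le hkn⟩
  choose r hr hsr using exists_normalForm hΛ o c
  have hr_inv : ∀ (g : GL (Fin n) ℂ) ρ, r (g • ρ) = r ρ := fun g ρ =>
    fibreInter.ext_fst fun i => by
      ext a b
      rw [hr, hr, normalFormEntry_smul]
  have hr_reg : ∀ x, (fun ρ => fibreInterCoord Λ x (r ρ)) ∈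
      regularFunctions (RankOneRep.coord Λ) := by
    have hsome : ∀ i a b, (fun ρ => ((r ρ).1.1 i).1 a b) ∈
        regularFunctions (RankOneRep.coord Λ) := fun i a b => by
      simp only [hr]
      exact normalFormEntry_mem_regularFunctions o c i a b
    rintro ⟨_ | i, a, b⟩
    · have : (fun ρ => fibreInterCoord Λ (none, a, b) (r ρ)) =
          -∑ i, fun ρ => ((r ρ).1.1 i).1 a b := by
        ext ρ
        exact (congrFun (congrFun (fibreInter.snd_eq (r ρ)) a) b).trans
          (by simp [Matrix.sum_apply])
      rw [this]
      exact neg_mem (sum_mem fun i _ => hsome i a b)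
    · exact hsome i a b
  have hrs : ∀ z, r (fibreRep z) ∈ MulAction.orbit (diagonalTorus n) z := fun z =>
    (fibreRep_mem_orbit_iff _ _).1 (hsr (fibreRep z))
  let e := invariantEquiv (G := GL (Fin n) ℂ) (H := diagonalTorus n)
    fibreRep r fibreRep_coord_mem_regularFunctions hr_reg
    (fun t z => ⟨t.1, (fibreRep_smul t z).symm⟩)
    (fun g ρ => by rw [hr_inv]; exact MulAction.mem_orbit_self _) hsr hrs
  refine ⟨fibreRep, gitQuotientIso e, fibreRep_p, fibreRep_q,
    gitPoint_comp_gitQuotientIso_hom e fibreRep fun _ _ => rfl, fibreRep_mem_orbit_iff,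
    exists_mem_orbit_fibreRep, fun z z' => ⟨fun h => ?_, fun h => ?_⟩,
    exists_gitPoint_eq fibreRep r fibreRep_coord_mem_regularFunctions hr_reg hr_inv hsr
      fibreInter.exists_eq_eval⟩
  · -- The entries of the normal form are invariants, and they determine the orbit.
    have : r (fibreRep z) = r (fibreRep z') := fibreInter.ext_fst fun i => by
      ext a b
      rw [hr, hr]
      exact gitPoint_eq_gitPoint_iff.1 h _ ⟨normalFormEntry_mem_regularFunctions o c i a b,
        normalFormEntry_smul o c i a b⟩
    rw [← MulAction.orbit_eq_iff, ← MulAction.orbit_eq_iff.2 (hrs z), this,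
      MulAction.orbit_eq_iff.2 (hrs z')]
  · exact gitPoint_eq_gitPoint_iff.2 fun f hf =>
      apply_eq_of_mem_orbit hf ((fibreRep_mem_orbit_iff z z').2 h)
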